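/- **Conventions.** Let $\Lambda$ be the set of terms of the pure $\lambda$-calculus (up to renaming of bound variables), with $\beta$-reduction $\to_\beta$ (finitely many steps, possibly none) and $\beta$-equivalence $\simeq_\beta$. A term is *normal* if it contains no $\beta$-redex, *normalizable* if it $\beta$-reduces to a normal term, and *closed* if it has no free variable. Weak head reduction $\succ_f$ is the reflexive and transitive closure of the steps $(\lambda x\,u)\,v\,v_1\cdots v_m \mapsto u[v/x]\,v_1\cdots v_m$ ($m\ge 0$). A set $G\subseteq\Lambda$ is *saturated* if $u\in G$ and $t\succ_f u$ imply $t\in G$. The types of system $\mathcal F$ are generated from a countably infinite set of type variables by $A\to B$ and $\forall X\,A$ (up to renaming of bound type variables). The $\forall^+$ types and the $\forall^-$ types are defined by simultaneous induction: - every type variable is both $\forall^+$ and $\forall^-$; - if $A$ is $\forall^+$ (resp. $\forall^-$) and $B$ is $\forall^-$ (resp. $\forall^+$), then $B\to A$ is $\forall^+$ (resp. $\forall^-$); - if $A$ is $\forall^+$ and $X$ is free in $A$, then $\forall X\,A$ is $\forall^+$. An *interpretation* $I$ assigns to every type variable $X$ a saturated set $|X|_I\subseteq\Lambda$; for a saturated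 set $G$, $I[X\leftarrow G]$ is the interpretation that takes the value $G$ at $X$ and agrees with $I$ elsewhere. It extends to all types by $$|A\to B|_I=\{u\in\Lambda : (u)t\in|B|_I \text{ for all } t\in|A|_I\},\qquad |\forall X\,A|_I=\bigcap_{G\text{ saturated}}|A|_{I[X\leftarrow G]}.$$ Finally $|A|=\bigcap_I |A|_I$, the intersection being over all interpretations $I$. **Corollary.** Let $A$ be a $\forall^+$ type of system $\mathcal F$ and let $t$ be a $\lambda$-term. (i) If $t\in|A|$, then $t$ is normalizable and $\beta$-equivalent to a closed term. (ii) $|A|$ is stable under $\beta$-equivalence: if $t\in|A|$ and $t\simeq_\beta t'$, then $t'\in|A|$. -/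

import Mathlib

namespace SystemF

/-! Terms of the pure lambda-calculus, up to renaming of bound variables (de Bruijn indices). The
free variables of a term are the natural numbers. -/

inductive LTerm : Type
  | var : ℕ → LTerm
  | app : LTerm → LTerm → LTerm
  | lam : LTerm → LTerm

namespace LTerm

/-- The renaming `ξ` carried under one binder. -/
def upRen (ξ : ℕ → ℕ) : ℕ → ℕ
  | 0 => 0
  | n + 1 => ξ n + 1

def rename : (ℕ → ℕ) → LTerm → LTerm
  | ξ, var n => var (ξ n)
  | ξ, app t u => app (rename ξ t) (rename ξ u)
  | ξ, lam t => lam (rename (upRen ξ) t)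

/-- The substitution `σ` carried under one binder. -/
def up (σ : ℕ → LTerm) : ℕ → LTerm
  | 0 => var 0
  | n + 1 => rename Nat.succ (σ n)

/-- Simultaneous capture-avoiding substitution of `σ n` for each free variable `n`. -/
def subst : (ℕ → LTerm) → LTerm → LTerm
  | σ, var n => σ n
  | σ, app t u => app (subst σ t) (subst σ u)
  | σ, lam t => lam (subst (up σ) t)

/-- The substitution sending variable `0` to `u` and lowering the other variables by one. -/
def single (u : LTerm) : ℕ → LTerm
  | 0 => u
  | n + 1 => var n

/-- The contractum `t[u/x]` of the redex `(λx t) u`, where `x` is the variable `0` of `t`. -/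
def inst (t u : LTerm) : LTerm := subst (single u) t

/-- The variable `n` is free in the term. -/
def FreeIn : ℕ → LTerm → Prop
  | n, var m => m = n
  | n, app t u => FreeIn n t ∨ FreeIn n u
  | n, lam t => FreeIn (n + 1) t

/-- A closed term has no free variable. -/
def Closed (t : LTerm) : Prop := ∀ n, ¬ FreeIn n t

/-- One step of beta-reduction, anywhere in the term. -/
inductive BetaStep : LTerm → LTerm → Prop
  | beta (t u : LTerm) : BetaStep (app (lam t) u) (inst t u)
  | appLeft {t t' : LTerm} (u : LTerm) : BetaStep t t' → BetaStep (app t u) (app t' u)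
  | appRight (t : LTerm) {u u' : LTerm} : BetaStep u u' → BetaStep (app t u) (app t u')
  | lam {t t' : LTerm} : BetaStep t t' → BetaStep (lam t) (lam t')

/-- Beta-reduction: finitely many (possibly zero) steps. -/
def BetaRed : LTerm → LTerm → Prop := Relation.ReflTransGen BetaStep

/-- Beta-equivalence: the equivalence relation generated by beta-reduction. -/
def BetaEquiv : LTerm → LTerm → Prop := Relation.EqvGen BetaStep

/-- A term without beta-redex. -/
def Normal (t : LTerm) : Prop := ∀ t', ¬ BetaStep t t'

/-- The term reduces to a normal form. -/
def Normalizable (t : LTerm) : Prop := ∃ t', BetaRed t t' ∧ Normal t'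

/-- One step of weak head reduction:
`(λx u) v v₁ ... vₘ` becomes `u[v/x] v₁ ... vₘ`. -/
inductive WeakHeadStep : LTerm → LTerm → Prop
  | beta (t u : LTerm) : WeakHeadStep (app (lam t) u) (inst t u)
  | app {t t' : LTerm} (u : LTerm) : WeakHeadStep t t' → WeakHeadStep (app t u) (app t' u)

/-- Weak head reduction: finitely many (possibly zero) steps. -/
def WeakHeadRed : LTerm → LTerm → Prop := Relation.ReflTransGen WeakHeadStep

/-- A set of terms is saturated if it is closed under weak head expansion. -/
def Saturated (G : Set LTerm) : Prop := ∀ t u, u ∈ G → WeakHeadRed t u → t ∈ G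

end LTerm

/-! Types of system F, up to renaming of bound type variables (de Bruijn indices). -/

inductive Ty : Type
  | var : ℕ → Ty
  | arr : Ty → Ty → Ty
  | all : Ty → Ty

namespace Ty

/-- The type variable `n` is free in the type. -/
def FreeIn : ℕ → Ty → Prop
  | n, var m => m = n
  | n, arr A B => FreeIn n A ∨ FreeIn n B
  | n, all A => FreeIn (n + 1) A

mutual

/-- Types with positive quantifiers. In `all`, the quantified variable has index `0` in `A` and
has to be free in `A`. -/
inductive Pos : Ty → Prop
  | var (n : ℕ) : Pos (var n)
  | arr {B A : Ty} : Neg B → Pos A → Pos (arr B A)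
  | all {A : Ty} : Pos A → FreeIn 0 A → Pos (all A)

/-- Types with negative quantifiers. -/
inductive Neg : Ty → Prop
  | var (n : ℕ) : Neg (var n)
  | arr {B A : Ty} : Pos B → Neg A → Neg (arr B A)

end

end Ty

/-- An interpretation assigns a saturated set of terms to each type variable. -/
def Interpretation : Type := ℕ → {G : Set LTerm // LTerm.Saturated G}

/-- The interpretation in which the newly bound type variable `0` has value `G` and the previous
variables, raised by one, keep their values. -/
def Interpretation.extend (I : Interpretation) (G : {G : Set LTerm // LTerm.Saturated G}) :
    Interpretation
  | 0 => G
  | n + 1 => I n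

namespace Ty

/-- The value `|A|_I` of a type in an interpretation. -/
def value : Ty → Interpretation → Set LTerm
  | var n, I => (I n).1
  | arr A B, I => {u | ∀ t ∈ value A I, LTerm.app u t ∈ value B I}
  | all A, I => ⋂ G : {G : Set LTerm // LTerm.Saturated G}, value A (I.extend G)

/-- The set `|A|`: the intersection of the values of `A` in all interpretations. -/
def sem (A : Ty) : Set LTerm := ⋂ I : Interpretation, value A I

end Ty

end SystemF

namespace SystemF

namespace LTerm

/-! ### Renaming and substitution -/

theorem rename_eq_subst (ξ : ℕ → ℕ) (t : LTerm) : rename ξ t = subst (fun n => var (ξ n)) t := by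
  induction t generalizing ξ with
  | var n => rfl
  | app t u iht ihu => simp only [rename, subst, iht, ihu]
  | lam t ih =>
    simp only [rename, subst, ih]
    congr 2
    funext n
    cases n <;> rfl

theorem subst_congr {σ τ : ℕ → LTerm} {t : LTerm} (h : ∀ n, FreeIn n t → σ n = τ n) :
    subst σ t = subst τ t := by
  induction t generalizing σ τ with
  | var n => exact h n rfl
  | app t u iht ihu =>
    simp only [subst]
    rw [iht fun n hn => h n (Or.inl hn), ihu fun n hn => h n (Or.inr hn)]
  | lam t ih =>
    simp only [subst]
    rw [ih]
    intro n hn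
    cases n with
    | zero => rfl
    | succ n => simp only [up, h n hn]

theorem subst_var (t : LTerm) : subst var t = t := by
  induction t with
  | var n => rfl
  | app t u iht ihu => simp only [subst, iht, ihu]
  | lam t ih =>
    simp only [subst]
    rw [show up var = var from funext fun n => by cases n <;> rfl, ih]

theorem subst_rename (σ : ℕ → LTerm) (ξ : ℕ → ℕ) (t : LTerm) :
    subst σ (rename ξ t) = subst (fun n => σ (ξ n)) t := by
  induction t generalizing σ ξ with
  | var n => rfl
  | app t u iht ihu => simp only [rename, subst, iht, ihu]
  | lam t ih =>
    simp only [rename, subst, ih]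
    congr 2
    funext n
    cases n <;> rfl

theorem rename_rename (ξ ζ : ℕ → ℕ) (t : LTerm) :
    rename ξ (rename ζ t) = rename (fun n => ξ (ζ n)) t := by
  rw [rename_eq_subst ξ, subst_rename, ← rename_eq_subst]

theorem rename_subst (ξ : ℕ → ℕ) (σ : ℕ → LTerm) (t : LTerm) :
    rename ξ (subst σ t) = subst (fun n => rename ξ (σ n)) t := by
  induction t generalizing σ ξ with
  | var n => rfl
  | app t u iht ihu => simp only [rename, subst, iht, ihu]
  | lam t ih =>
    simp only [rename, subst, ih]
    congr 2
    funext n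
    cases n with
    | zero => rfl
    | succ n => simp only [up, rename_rename, upRen]

theorem subst_subst (σ τ : ℕ → LTerm) (t : LTerm) :
    subst σ (subst τ t) = subst (fun n => subst σ (τ n)) t := by
  induction t generalizing σ τ with
  | var n => rfl
  | app t u iht ihu => simp only [subst, iht, ihu]
  | lam t ih =>
    simp only [subst, ih]
    congr 2
    funext n
    cases n with
    | zero => rfl
    | succ n => simp only [up, subst_rename, rename_subst]

theorem subst_inst (σ : ℕ → LTerm) (t u : LTerm) :
    subst σ (inst t u) = inst (subst (up σ) t) (subst σ u) := by
  simp only [inst, subst_subst]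
  congr 1
  funext n
  cases n with
  | zero => rfl
  | succ n => simp only [up, subst_rename, single, subst, subst_var]

theorem rename_inst (ξ : ℕ → ℕ) (t u : LTerm) :
    rename ξ (inst t u) = inst (rename (upRen ξ) t) (rename ξ u) := by
  simp only [inst, rename_subst, subst_rename]
  congr 1
  funext n
  cases n <;> rfl

/-- The renaming that sends variable `0` to `x` and lowers the other variables by one. -/
def singleRen (x : ℕ) : ℕ → ℕ
  | 0 => x
  | n + 1 => n

theorem inst_var (t : LTerm) (x : ℕ) : inst t (var x) = rename (singleRen x) t := by
  rw [rename_eq_subst, inst]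
  congr 1
  funext n
  cases n <;> rfl

/-! ### Free variables -/

theorem freeIn_rename {ξ : ℕ → ℕ} {t : LTerm} {n : ℕ} :
    FreeIn n (rename ξ t) ↔ ∃ m, FreeIn m t ∧ ξ m = n := by
  induction t generalizing ξ n with
  | var m => simp [rename, FreeIn]
  | app t u iht ihu => simp only [rename, FreeIn, iht, ihu, or_and_right, exists_or]
  | lam t ih =>
    simp only [rename, FreeIn, ih]
    constructor
    · rintro ⟨m, hm, h⟩
      cases m with
      | zero => simp [upRen] at h
      | succ m => exact ⟨m, hm, by simpa [upRen] using h⟩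
    · rintro ⟨m, hm, rfl⟩
      exact ⟨m + 1, hm, rfl⟩

theorem FreeIn.of_subst {σ : ℕ → LTerm} {t : LTerm} {n : ℕ} (h : FreeIn n (subst σ t)) :
    ∃ m, FreeIn m t ∧ FreeIn n (σ m) := by
  induction t generalizing σ n with
  | var m => exact ⟨m, rfl, h⟩
  | app t u iht ihu =>
    rcases h with h | h
    · obtain ⟨m, hm, h⟩ := iht h
      exact ⟨m, Or.inl hm, h⟩
    · obtain ⟨m, hm, h⟩ := ihu h
      exact ⟨m, Or.inr hm, h⟩
  | lam t ih =>
    obtain ⟨m, hm, h⟩ := ih h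
    cases m with
    | zero => simp [up, FreeIn] at h
    | succ m =>
      obtain ⟨k, hk, h⟩ := freeIn_rename.1 h
      cases h
      exact ⟨m, hm, hk⟩

theorem FreeIn.of_inst {t u : LTerm} {n : ℕ} (h : FreeIn n (inst t u)) :
    FreeIn (n + 1) t ∨ FreeIn n u := by
  obtain ⟨m, hm, h⟩ := FreeIn.of_subst h
  cases m with
  | zero => exact Or.inr h
  | succ m =>
    cases h
    exact Or.inl hm

theorem BetaStep.freeIn {t u : LTerm} (h : BetaStep t u) {n : ℕ} (hn : FreeIn n u) :
    FreeIn n t := by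
  induction h generalizing n with
  | beta t u => exact FreeIn.of_inst hn
  | appLeft u _ ih => exact hn.imp ih id
  | appRight t _ ih => exact hn.imp id ih
  | lam _ ih => exact ih hn

theorem BetaRed.freeIn {t u : LTerm} (h : BetaRed t u) {n : ℕ} (hn : FreeIn n u) :
    FreeIn n t := by
  induction h with
  | refl => exact hn
  | tail _ h ih => exact ih (h.freeIn hn)

theorem exists_forall_freeIn_lt (t : LTerm) : ∃ N, ∀ n, FreeIn n t → n < N := by
  induction t with
  | var m => exact ⟨m + 1, fun n hn => by cases hn; omega⟩
  | app t u iht ihu =>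
    obtain ⟨N, hN⟩ := iht
    obtain ⟨M, hM⟩ := ihu
    exact ⟨max N M, fun n hn => hn.elim (fun h => lt_max_of_lt_left (hN n h))
      fun h => lt_max_of_lt_right (hM n h)⟩
  | lam t ih =>
    obtain ⟨N, hN⟩ := ih
    exact ⟨N, fun n hn => (Nat.lt_succ_self n).trans (hN _ hn)⟩

/-! ### Beta-reduction -/

theorem BetaRed.refl (t : LTerm) : BetaRed t t := Relation.ReflTransGen.refl

theorem BetaRed.trans {t u v : LTerm} (h : BetaRed t u) (h' : BetaRed u v) : BetaRed t v :=
  Relation.ReflTransGen.trans h h'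

theorem BetaRed.lam {t u : LTerm} (h : BetaRed t u) : BetaRed (lam t) (lam u) :=
  Relation.ReflTransGen.lift LTerm.lam (fun _ _ => BetaStep.lam) _ _ h

theorem BetaRed.app {t t' u u' : LTerm} (h : BetaRed t t') (h' : BetaRed u u') :
    BetaRed (app t u) (app t' u') :=
  (Relation.ReflTransGen.lift (fun t => LTerm.app t u) (fun _ _ => BetaStep.appLeft u) _ _ h).trans
    (Relation.ReflTransGen.lift (LTerm.app t') (fun _ _ => BetaStep.appRight t') _ _ h')

theorem BetaRed.betaEquiv {t u : LTerm} (h : BetaRed t u) : BetaEquiv t u := by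
  induction h with
  | refl => exact Relation.EqvGen.refl _
  | tail _ h ih => exact Relation.EqvGen.trans _ _ _ ih (Relation.EqvGen.rel _ _ h)

theorem BetaStep.subst {t u : LTerm} (h : BetaStep t u) (σ : ℕ → LTerm) :
    BetaStep (subst σ t) (LTerm.subst σ u) := by
  induction h generalizing σ with
  | beta t u =>
    rw [subst_inst]
    exact BetaStep.beta _ _
  | appLeft u _ ih => exact BetaStep.appLeft _ (ih σ)
  | appRight t _ ih => exact BetaStep.appRight _ (ih σ)
  | lam _ ih => exact BetaStep.lam (ih _)

theorem BetaRed.rename {t u : LTerm} (h : BetaRed t u) (ξ : ℕ → ℕ) :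
    BetaRed (rename ξ t) (LTerm.rename ξ u) :=
  Relation.ReflTransGen.lift (LTerm.rename ξ)
    (fun _ _ h => by simpa only [Function.onFun, rename_eq_subst] using h.subst _) _ _ h

theorem BetaRed.subst_of_pointwise {σ τ : ℕ → LTerm} (h : ∀ n, BetaRed (σ n) (τ n)) (t : LTerm) :
    BetaRed (subst σ t) (subst τ t) := by
  induction t generalizing σ τ with
  | var n => exact h n
  | app t u iht ihu => exact (iht h).app (ihu h)
  | lam t ih =>
    refine (ih fun n => ?_).lam
    cases n with
    | zero => exact BetaRed.refl _
    | succ n => exact (h n).rename _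

theorem BetaRed.inst_right (t : LTerm) {u u' : LTerm} (h : BetaRed u u') :
    BetaRed (inst t u) (inst t u') := by
  refine BetaRed.subst_of_pointwise (fun n => ?_) t
  cases n with
  | zero => exact h
  | succ n => exact BetaRed.refl _

theorem BetaStep.of_rename {ξ : ℕ → ℕ} {t u : LTerm} (h : BetaStep (rename ξ t) u) :
    ∃ t', BetaStep t t' ∧ rename ξ t' = u := by
  induction t generalizing ξ u with
  | var n => cases h
  | lam t ih =>
    cases h with
    | lam h =>
      obtain ⟨t', hs, rfl⟩ := ih h
      exact ⟨LTerm.lam t', hs.lam, rfl⟩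
  | app t s iht ihs =>
    generalize ht : rename ξ (app t s) = r at h
    cases h with
    | beta a b =>
      cases t with
      | lam a' =>
        simp only [rename, app.injEq, lam.injEq] at ht
        obtain ⟨rfl, rfl⟩ := ht
        exact ⟨inst a' s, BetaStep.beta _ _, rename_inst _ _ _⟩
      | var n => simp [rename] at ht
      | app a' b' => simp [rename] at ht
    | appLeft b h =>
      simp only [rename, app.injEq] at ht
      obtain ⟨rfl, rfl⟩ := ht
      obtain ⟨t', hs, rfl⟩ := iht h
      exact ⟨app t' s, hs.appLeft _, rfl⟩
    | appRight a h =>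
      simp only [rename, app.injEq] at ht
      obtain ⟨rfl, rfl⟩ := ht
      obtain ⟨s', hs, rfl⟩ := ihs h
      exact ⟨app t s', hs.appRight _, rfl⟩
    | lam h => simp [rename] at ht

theorem BetaRed.of_rename {ξ : ℕ → ℕ} {t u : LTerm} (h : BetaRed (LTerm.rename ξ t) u) :
    ∃ t', BetaRed t t' ∧ LTerm.rename ξ t' = u := by
  induction h with
  | refl => exact ⟨t, BetaRed.refl t, rfl⟩
  | tail _ h ih =>
    obtain ⟨t', ht, rfl⟩ := ih
    obtain ⟨t'', hs, rfl⟩ := h.of_rename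
    exact ⟨t'', Relation.ReflTransGen.tail ht hs, rfl⟩

theorem Normal.of_rename {ξ : ℕ → ℕ} {t : LTerm} (h : Normal (rename ξ t)) : Normal t := by
  intro t' ht
  refine h (rename ξ t') ?_
  simpa only [rename_eq_subst] using ht.subst _

theorem Normal.lam {t : LTerm} (h : Normal t) : Normal (lam t) := by
  intro t' ht
  cases ht with
  | lam ht => exact h _ ht

theorem exists_normal_of_app_var {t n : LTerm} {x : ℕ} (h : BetaRed (app t (var x)) n)
    (hn : Normal n) : ∃ s, BetaRed t s ∧ Normal s ∧ ∀ k, FreeIn k s → FreeIn k n := by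
  generalize hr : app t (var x) = r at h
  induction h using Relation.ReflTransGen.head_induction_on generalizing t with
  | refl =>
    subst hr
    exact ⟨t, BetaRed.refl t, fun t' ht => hn _ (ht.appLeft _), fun k hk => Or.inl hk⟩
  | head h h' ih =>
    cases h with
    | beta a b =>
      cases hr
      rw [inst_var] at h'
      obtain ⟨a', ha, rfl⟩ := BetaRed.of_rename h'
      exact ⟨LTerm.lam a', ha.lam, hn.of_rename.lam, fun k hk => freeIn_rename.2 ⟨k + 1, hk, rfl⟩⟩
    | appLeft u h =>
      cases hr
      obtain ⟨s, hs, hs'⟩ := ih rfl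
      exact ⟨s, Relation.ReflTransGen.head h hs, hs'⟩
    | appRight t h =>
      cases hr
      cases h
    | lam h => cases hr

/-! ### Neutral terms -/

/-- A variable applied to finitely many terms. -/
inductive Neutral : LTerm → Prop
  | var (x : ℕ) : Neutral (var x)
  | app {t : LTerm} (u : LTerm) : Neutral t → Neutral (app t u)

theorem Neutral.normal_app {t u : LTerm} (h : Neutral t) (ht : Normal t) (hu : Normal u) :
    Normal (LTerm.app t u) := by
  intro s hs
  cases hs with
  | beta a b => cases h
  | appLeft u h' => exact ht _ h'
  | appRight t h' => exact hu _ h'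

theorem Neutral.betaStep {t u : LTerm} (h : Neutral t) (hs : BetaStep t u) : Neutral u := by
  induction h generalizing u with
  | var x => cases hs
  | app v h ih =>
    cases hs with
    | beta a b => cases h
    | appLeft _ hs => exact (ih hs).app _
    | appRight _ hs => exact h.app _

theorem Neutral.betaRed_app {t u w : LTerm} (h : Neutral t) (hr : BetaRed (LTerm.app t u) w) :
    ∃ t' u', w = LTerm.app t' u' ∧ BetaRed t t' ∧ BetaRed u u' ∧ Neutral t' := by
  induction hr with
  | refl => exact ⟨t, u, rfl, BetaRed.refl t, BetaRed.refl u, h⟩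
  | tail _ hs ih =>
    obtain ⟨t', u', rfl, ht, hu, hn⟩ := ih
    cases hs with
    | beta a b => cases hn
    | appLeft _ hs => exact ⟨_, _, rfl, Relation.ReflTransGen.tail ht hs, hu, hn.betaStep hs⟩
    | appRight _ hs => exact ⟨_, _, rfl, ht, Relation.ReflTransGen.tail hu hs, hn⟩

/-! ### Weak head reduction -/

theorem WeakHeadStep.betaStep {t u : LTerm} (h : WeakHeadStep t u) : BetaStep t u := by
  induction h with
  | beta t u => exact BetaStep.beta t u
  | app u _ ih => exact ih.appLeft u

theorem WeakHeadRed.refl (t : LTerm) : WeakHeadRed t t := Relation.ReflTransGen.refl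

theorem WeakHeadRed.trans {t u v : LTerm} (h : WeakHeadRed t u) (h' : WeakHeadRed u v) :
    WeakHeadRed t v :=
  Relation.ReflTransGen.trans h h'

theorem WeakHeadRed.betaRed {t u : LTerm} (h : WeakHeadRed t u) : BetaRed t u :=
  Relation.ReflTransGen.mono (fun _ _ => WeakHeadStep.betaStep) _ _ h

theorem WeakHeadRed.app {t t' : LTerm} (h : WeakHeadRed t t') (u : LTerm) :
    WeakHeadRed (app t u) (app t' u) :=
  Relation.ReflTransGen.lift (fun t => LTerm.app t u) (fun _ _ => WeakHeadStep.app u) _ _ h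

theorem WeakHeadStep.subst {t u : LTerm} (h : WeakHeadStep t u) (σ : ℕ → LTerm) :
    WeakHeadStep (subst σ t) (LTerm.subst σ u) := by
  induction h with
  | beta t u =>
    rw [subst_inst]
    exact WeakHeadStep.beta _ _
  | app u _ ih => exact ih.app _

theorem WeakHeadRed.subst {t u : LTerm} (h : WeakHeadRed t u) (σ : ℕ → LTerm) :
    WeakHeadRed (subst σ t) (LTerm.subst σ u) :=
  Relation.ReflTransGen.lift (LTerm.subst σ) (fun _ _ h => h.subst σ) _ _ h

theorem WeakHeadRed.rename {t u : LTerm} (h : WeakHeadRed t u) (ξ : ℕ → ℕ) :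
    WeakHeadRed (rename ξ t) (LTerm.rename ξ u) := by
  simpa only [rename_eq_subst] using h.subst _

/-- Beta-steps preserve weak head redexes, unless they contract them. -/
theorem WeakHeadStep.commute_betaStep {t u t' : LTerm} (h : WeakHeadStep t u)
    (h' : BetaStep t t') : ∃ u', BetaRed u u' ∧ (t' = u' ∨ WeakHeadStep t' u') := by
  induction h generalizing t' with
  | beta a b =>
    cases h' with
    | beta => exact ⟨_, BetaRed.refl _, Or.inl rfl⟩
    | appLeft _ h' =>
      cases h' with
      | lam h' =>
        exact ⟨_, Relation.ReflTransGen.single (h'.subst _), Or.inr (WeakHeadStep.beta _ _)⟩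
    | appRight _ h' =>
      exact ⟨_, BetaRed.inst_right a (Relation.ReflTransGen.single h'),
        Or.inr (WeakHeadStep.beta _ _)⟩
  | app b h ih =>
    cases h' with
    | beta => cases h
    | appLeft _ h' =>
      obtain ⟨u', hu, h'⟩ := ih h'
      exact ⟨_, hu.app (BetaRed.refl b), h'.imp (fun h => by rw [h]) fun h => h.app b⟩
    | appRight _ h' => exact ⟨_, (BetaRed.refl _).app (Relation.ReflTransGen.single h'),
        Or.inr (h.app _)⟩

theorem WeakHeadStep.commute_betaRed {t u t' : LTerm} (h : WeakHeadStep t u)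
    (h' : BetaRed t t') : ∃ u', BetaRed u u' ∧ (t' = u' ∨ WeakHeadStep t' u') := by
  induction h' with
  | refl => exact ⟨u, BetaRed.refl u, Or.inr h⟩
  | tail _ hs ih =>
    obtain ⟨u', hu, rfl | hu'⟩ := ih
    · exact ⟨_, Relation.ReflTransGen.tail hu hs, Or.inl rfl⟩
    · obtain ⟨u'', hr, hu''⟩ := hu'.commute_betaStep hs
      exact ⟨u'', hu.trans hr, hu''⟩

theorem WeakHeadRed.commute_betaRed {t u t' : LTerm} (h : WeakHeadRed t u)
    (h' : BetaRed t t') : ∃ u', BetaRed u u' ∧ WeakHeadRed t' u' := by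
  induction h with
  | refl => exact ⟨t', h', WeakHeadRed.refl t'⟩
  | tail _ hs ih =>
    obtain ⟨u', hu, hw⟩ := ih
    obtain ⟨u'', hu', rfl | hs'⟩ := hs.commute_betaRed hu
    · exact ⟨_, hu', hw⟩
    · exact ⟨_, hu', Relation.ReflTransGen.tail hw hs'⟩

/-! ### Standardization -/

/-- Standard reduction: weak head reduction followed by standard reductions of the immediate
subterms. -/
inductive StandardRed : LTerm → LTerm → Prop
  | var {t : LTerm} (x : ℕ) : WeakHeadRed t (var x) → StandardRed t (var x)
  | app {t a b a' b' : LTerm} : WeakHeadRed t (app a b) → StandardRed a a' → StandardRed b b' →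
      StandardRed t (app a' b')
  | lam {t a a' : LTerm} : WeakHeadRed t (lam a) → StandardRed a a' → StandardRed t (lam a')

theorem StandardRed.refl (t : LTerm) : StandardRed t t := by
  induction t with
  | var n => exact .var n (WeakHeadRed.refl _)
  | app t u iht ihu => exact .app (WeakHeadRed.refl _) iht ihu
  | lam t ih => exact .lam (WeakHeadRed.refl _) ih

theorem StandardRed.head {t u v : LTerm} (h : WeakHeadRed t u) (h' : StandardRed u v) :
    StandardRed t v := by
  cases h' with
  | var x h' => exact .var x (h.trans h')
  | app h' ha hb => exact .app (h.trans h') ha hb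
  | lam h' ha => exact .lam (h.trans h') ha

theorem StandardRed.betaRed {t u : LTerm} (h : StandardRed t u) : BetaRed t u := by
  induction h with
  | var x h => exact h.betaRed
  | app h _ _ iha ihb => exact h.betaRed.trans (iha.app ihb)
  | lam h _ ih => exact h.betaRed.trans ih.lam

theorem StandardRed.rename {t u : LTerm} (h : StandardRed t u) (ξ : ℕ → ℕ) :
    StandardRed (rename ξ t) (LTerm.rename ξ u) := by
  induction h generalizing ξ with
  | var x h => exact .var _ (h.rename ξ)
  | app h _ _ iha ihb => exact .app (h.rename ξ) (iha ξ) (ihb ξ)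
  | lam h _ ih => exact .lam (h.rename ξ) (ih _)

theorem StandardRed.subst {t u : LTerm} (h : StandardRed t u) {σ τ : ℕ → LTerm}
    (hσ : ∀ n, StandardRed (σ n) (τ n)) : StandardRed (subst σ t) (LTerm.subst τ u) := by
  induction h generalizing σ τ with
  | var x h => exact .head (h.subst σ) (hσ x)
  | app h _ _ iha ihb => exact .app (h.subst σ) (iha hσ) (ihb hσ)
  | lam h _ ih =>
    refine .lam (h.subst σ) (ih fun n => ?_)
    cases n with
    | zero => exact .refl _
    | succ n => exact (hσ n).rename _

theorem StandardRed.tail {t u v : LTerm} (h : StandardRed t u) (h' : BetaStep u v) :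
    StandardRed t v := by
  induction h generalizing v with
  | var x h => cases h'
  | lam h _ ih =>
    cases h' with
    | lam h' => exact .lam h (ih h')
  | app h ha hb iha ihb =>
    cases h' with
    | beta c d =>
      cases ha with
      | lam hw hc =>
        refine .head ((h.trans (hw.app _)).trans
          (Relation.ReflTransGen.single (WeakHeadStep.beta _ _))) (hc.subst fun n => ?_)
        cases n with
        | zero => exact hb
        | succ n => exact .refl _
    | appLeft _ h' => exact .app h (iha h') hb
    | appRight _ h' => exact .app h ha (ihb h')

/-- Every beta-reduction can be standardized. -/
theorem BetaRed.standardRed {t u : LTerm} (h : BetaRed t u) : StandardRed t u := by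
  induction h with
  | refl => exact .refl t
  | tail _ h ih => exact ih.tail h

/-! ### Relations compatible with weak head reduction and neutral terms -/

/-- The properties shared by beta-reduction and its converse on which the invariance of the
values of types rests. -/
structure HeadCompatible (R : LTerm → LTerm → Prop) : Prop where
  app_right : ∀ {t t' : LTerm} (u : LTerm), R t t' → R (app t u) (app t' u)
  commute : ∀ {t u t' : LTerm}, WeakHeadRed t u → R t t' → ∃ u', R u u' ∧ WeakHeadRed t' u'
  var : ∀ {x : ℕ} {t : LTerm}, R (var x) t → WeakHeadRed t (var x)
  neutral : ∀ {t u w : LTerm}, Neutral t → R (app t u) w →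
    ∃ t' u', WeakHeadRed w (app t' u') ∧ R t t' ∧ R u u'

theorem headCompatible_betaRed : HeadCompatible BetaRed where
  app_right u h := h.app (BetaRed.refl u)
  commute h h' := h.commute_betaRed h'
  var {x t} h := by
    rcases Relation.ReflTransGen.cases_head h with rfl | ⟨_, h, _⟩
    · exact WeakHeadRed.refl _
    · cases h
  neutral ht h := by
    obtain ⟨t', u', rfl, ht, hu, -⟩ := ht.betaRed_app h
    exact ⟨t', u', WeakHeadRed.refl _, ht, hu⟩

theorem headCompatible_flip_betaRed : HeadCompatible (flip BetaRed) where
  app_right u h := BetaRed.app h (BetaRed.refl u)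
  commute {t u t'} h h' := ⟨t', BetaRed.trans h' h.betaRed, WeakHeadRed.refl t'⟩
  var h := by
    cases BetaRed.standardRed h with
    | var x h => exact h
  neutral _ h := by
    cases BetaRed.standardRed h with
    | app h ha hb => exact ⟨_, _, h, ha.betaRed, hb.betaRed⟩

end LTerm

open LTerm

namespace Ty

/-! ### Values of types -/

theorem saturated_value (A : Ty) (I : Interpretation) : Saturated (value A I) := by
  induction A generalizing I with
  | var n => exact (I n).2
  | arr A B _ ihB => exact fun t u hu h v hv => ihB I _ _ (hu v hv) (h.app v)
  | all A ih =>
    intro t u hu h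
    simp only [value, Set.mem_iInter] at hu ⊢
    exact fun G => ih _ t u (hu G) h

theorem value_congr {A : Ty} {I J : Interpretation} (h : ∀ n, FreeIn n A → I n = J n) :
    value A I = value A J := by
  induction A generalizing I J with
  | var n => simp only [value, h n rfl]
  | arr A B ihA ihB =>
    simp only [value]
    rw [ihA fun n hn => h n (Or.inl hn), ihB fun n hn => h n (Or.inr hn)]
  | all A ih =>
    simp only [value]
    congr 1
    funext G
    refine ih fun n hn => ?_
    cases n with
    | zero => rfl
    | succ n => exact h n hn

/-- Renaming of the free type variables. -/
def rename : (ℕ → ℕ) → Ty → Ty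
  | ρ, var n => var (ρ n)
  | ρ, arr A B => arr (rename ρ A) (rename ρ B)
  | ρ, all A => all (rename (upRen ρ) A)

theorem value_rename (ρ : ℕ → ℕ) (A : Ty) (I : Interpretation) :
    value (rename ρ A) I = value A fun n => I (ρ n) := by
  induction A generalizing ρ I with
  | var n => rfl
  | arr A B ihA ihB => simp only [rename, value, ihA, ihB]
  | all A ih =>
    simp only [rename, value, ih]
    congr 1
    funext G
    congr 1
    funext n
    cases n <;> rfl

theorem exists_forall_freeIn_lt (A : Ty) : ∃ N, ∀ n, FreeIn n A → n < N := by
  induction A with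
  | var m => exact ⟨m + 1, fun n hn => by cases hn; omega⟩
  | arr A B ihA ihB =>
    obtain ⟨N, hN⟩ := ihA
    obtain ⟨M, hM⟩ := ihB
    exact ⟨max N M, fun n hn => hn.elim (fun h => lt_max_of_lt_left (hN n h))
      fun h => lt_max_of_lt_right (hM n h)⟩
  | all A ih =>
    obtain ⟨N, hN⟩ := ih
    exact ⟨N, fun n hn => (Nat.lt_succ_self n).trans (hN _ hn)⟩

/-- An injective coding of types by natural numbers. -/
def code : Ty → ℕ
  | var n => Nat.pair 0 n
  | arr A B => Nat.pair 1 (Nat.pair (code A) (code B))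
  | all A => Nat.pair 2 (code A)

theorem code_injective : Function.Injective code := by
  intro A
  induction A with
  | var n => intro B h; cases B <;> simp_all [code, Nat.pair_eq_pair]
  | arr A A' ih ih' =>
    intro B h
    cases B with
    | arr B B' =>
      simp only [code, Nat.pair_eq_pair, true_and] at h
      rw [ih h.1, ih' h.2]
    | var n => simp [code, Nat.pair_eq_pair] at h
    | all B => simp [code, Nat.pair_eq_pair] at h
  | all A ih =>
    intro B h
    cases B with
    | all B =>
      simp only [code, Nat.pair_eq_pair, true_and] at h
      rw [ih h]
    | var n => simp [code, Nat.pair_eq_pair] at h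
    | arr B B' => simp [code, Nat.pair_eq_pair] at h

/-! ### Normalization -/

/-- The terms that have a normal form with free variables in `V`. -/
def normalizing (V : Set ℕ) : {G : Set LTerm // Saturated G} :=
  ⟨{t | ∃ n, BetaRed t n ∧ Normal n ∧ ∀ k, LTerm.FreeIn k n → k ∈ V},
    fun _ _ ⟨n, hn, h⟩ hw => ⟨n, hw.betaRed.trans hn, h⟩⟩

theorem extend_const (G : {G : Set LTerm // Saturated G}) :
    Interpretation.extend (fun _ => G) G = fun _ => G := by
  funext n
  cases n <;> rfl

mutual

theorem Pos.value_subset_normalizing {V : Set ℕ} {x : ℕ} (hx : x ∈ V) {A : Ty} (hA : Pos A) :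
    value A (fun _ => normalizing V) ⊆ (normalizing V).1 := by
  cases hA with
  | var n => exact subset_rfl
  | arr hB hA =>
    intro t ht
    obtain ⟨n, hn, hn', hV⟩ := hA.value_subset_normalizing hx
      (ht _ (hB.mem_value_normalizing hx (BetaRed.refl (LTerm.var x))
        (fun _ h => by cases h) (Neutral.var x) fun k hk => by cases hk; exact hx))
    obtain ⟨s, hs, hs', hf⟩ := exists_normal_of_app_var hn hn'
    exact ⟨s, hs, hs', fun k hk => hV k (hf k hk)⟩
  | all hA _ =>
    intro t ht
    have := Set.mem_iInter.1 ht (normalizing V)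
    rw [extend_const] at this
    exact hA.value_subset_normalizing hx this

theorem Neg.mem_value_normalizing {V : Set ℕ} {x : ℕ} (hx : x ∈ V) {A : Ty} (hA : Neg A)
    {t n : LTerm} (ht : BetaRed t n) (hn : Normal n) (hn' : Neutral n)
    (hV : ∀ k, LTerm.FreeIn k n → k ∈ V) : t ∈ value A fun _ => normalizing V := by
  cases hA with
  | var m => exact ⟨n, ht, hn, hV⟩
  | arr hB hA =>
    intro u hu
    obtain ⟨m, hm, hm', hV'⟩ := hB.value_subset_normalizing hx hu
    exact hA.mem_value_normalizing hx (ht.app hm) (hn'.normal_app hn hm') (hn'.app m)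
      fun k hk => hk.elim (hV k) (hV' k)

end

theorem Pos.exists_normal_closed {A : Ty} (hA : Pos A) {t : LTerm} (ht : t ∈ A.sem) :
    ∃ n, BetaRed t n ∧ Normal n ∧ Closed n := by
  obtain ⟨N, hN⟩ := LTerm.exists_forall_freeIn_lt t
  have hx : N ∈ {k | ¬ LTerm.FreeIn k t} := fun h => lt_irrefl _ (hN N h)
  obtain ⟨n, hn, hn', hV⟩ := hA.value_subset_normalizing hx (Set.mem_iInter.1 ht _)
  exact ⟨n, hn, hn', fun k hk => hV k hk (hn.freeIn hk)⟩

/-! ### Invariance under beta-equivalence -/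

/-- The substitution `σ` realizes the context `Γ` on the free variables of `t`. Variables that
have no type in `Γ` are not constrained. -/
def Realizes (Γ : ℕ → Option Ty) (I : Interpretation) (σ : ℕ → LTerm) (t : LTerm) : Prop :=
  ∀ x, LTerm.FreeIn x t → ∀ B, Γ x = some B → σ x ∈ value B I

/-- All terms related to `t` by `R` have values in `A` under realizing substitutions. -/
def Valid (R : LTerm → LTerm → Prop) (Γ : ℕ → Option Ty) (t : LTerm) (A : Ty) : Prop :=
  ∀ t', R t t' → ∀ I σ, Realizes Γ I σ t' → subst σ t' ∈ value A I

theorem Realizes.of_weakHeadRed {Γ : ℕ → Option Ty} {I : Interpretation} {σ : ℕ → LTerm}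
    {t u : LTerm} (h : Realizes Γ I σ t) (hw : WeakHeadRed t u) : Realizes Γ I σ u :=
  fun x hx => h x (hw.betaRed.freeIn hx)

theorem saturated_valid {R : LTerm → LTerm → Prop} (hR : HeadCompatible R) (Γ : ℕ → Option Ty)
    (A : Ty) : Saturated {t | Valid R Γ t A} := by
  intro t u hu hw t' ht I σ hσ
  obtain ⟨u', hu', hw'⟩ := hR.commute hw ht
  exact saturated_value A I _ _ (hu u' hu' I σ (hσ.of_weakHeadRed hw')) (hw'.subst σ)

theorem valid_var {R : LTerm → LTerm → Prop} (hR : HeadCompatible R) {Γ : ℕ → Option Ty} {x : ℕ}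
    {B : Ty} (hx : Γ x = some B) : Valid R Γ (LTerm.var x) B := fun _ ht I σ hσ =>
  have hw := hR.var ht
  saturated_value B I _ _ (hσ.of_weakHeadRed hw x rfl B hx) (hw.subst σ)

/-- The interpretation of type variables by valid terms. -/
def canonical {R : LTerm → LTerm → Prop} (hR : HeadCompatible R) (Γ : ℕ → Option Ty) :
    Interpretation :=
  fun n => ⟨{t | Valid R Γ t (var n)}, saturated_valid hR Γ (var n)⟩

theorem Realizes.update {Γ : ℕ → Option Ty} {I : Interpretation} {σ : ℕ → LTerm} {t : LTerm}
    (h : Realizes Γ I σ t) {x : ℕ} {B : Ty} (hx : Γ x = some B) {v : LTerm}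
    (hv : v ∈ value B I) :
    Realizes Γ I (Function.update σ x v) (LTerm.app t (LTerm.var x)) := by
  intro y hy C hC
  by_cases hyx : y = x
  · subst hyx
    rw [hx] at hC
    cases hC
    rwa [Function.update_self]
  · rw [Function.update_of_ne hyx]
    exact h y (hy.resolve_right fun h => hyx h.symm) C hC

theorem exists_fresh (Γ : ℕ → Option Ty) (t : LTerm) (A : Ty) :
    ∃ Y, ¬ FreeIn Y A ∧ ∀ x, LTerm.FreeIn x t → ∀ B, Γ x = some B → ¬ FreeIn Y B := by
  obtain ⟨N, hN⟩ := LTerm.exists_forall_freeIn_lt t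
  obtain ⟨K, hK⟩ := A.exists_forall_freeIn_lt
  have (x : ℕ) : ∃ M, ∀ B, Γ x = some B → ∀ n, FreeIn n B → n < M := by
    cases hx : Γ x with
    | none => exact ⟨0, fun B hB => by cases hB⟩
    | some B =>
      obtain ⟨M, hM⟩ := B.exists_forall_freeIn_lt
      exact ⟨M, fun C hC => by cases hC; exact hM⟩
  choose M hM using this
  refine ⟨max K ((Finset.range N).sup M), fun h => (hK _ h).not_ge (le_max_left _ _),
    fun x hx B hB h => (hM x B hB _ h).not_ge ?_⟩
  exact (Finset.le_sup (f := M) (Finset.mem_range.2 (hN x hx))).trans (le_max_right _ _)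

/-- The renaming under one quantifier that sends the bound variable to `Y`. -/
def consRen (Y : ℕ) (ρ : ℕ → ℕ) : ℕ → ℕ
  | 0 => Y
  | n + 1 => ρ n

theorem FreeIn.rename {ρ : ℕ → ℕ} {A : Ty} {n : ℕ} (h : FreeIn n A) :
    FreeIn (ρ n) (rename ρ A) := by
  induction A generalizing ρ n with
  | var m => cases h; rfl
  | arr A B ihA ihB => exact h.imp ihA ihB
  | all A ih => exact ih (ρ := upRen ρ) h

/-- The interpretation with the value at `Y` replaced by `G`. -/
def update (I : Interpretation) (Y : ℕ) (G : {G : Set LTerm // Saturated G}) : Interpretation :=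
  fun n => if n = Y then G else I n

theorem value_update {I : Interpretation} {Y : ℕ} {G : {G : Set LTerm // Saturated G}} {A : Ty}
    (h : ¬ FreeIn Y A) : value A (update I Y G) = value A I :=
  value_congr fun n hn => if_neg (c := n = Y) fun e => h (e ▸ hn)

theorem valid_all {R : LTerm → LTerm → Prop} {Γ : ℕ → Option Ty} {t : LTerm} {A : Ty} {ρ : ℕ → ℕ}
    (h : ∀ Y, Valid R Γ t (rename (consRen Y ρ) A)) : Valid R Γ t (rename ρ (all A)) := by
  intro t' ht I σ hσ
  rw [value_rename]
  refine Set.mem_iInter.2 fun G => ?_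
  obtain ⟨Y, hYA, hYΓ⟩ := exists_fresh Γ t' (rename ρ (all A))
  have key := h Y t' ht (update I Y G) σ fun x hx B hB => by
    rw [value_update (hYΓ x hx B hB)]
    exact hσ x hx B hB
  rw [value_rename] at key
  refine (value_congr fun n hn => ?_).subset key
  cases n with
  | zero => exact if_pos rfl
  | succ n => exact if_neg (c := ρ n = Y) fun e => hYA (e ▸ FreeIn.rename (A := all A) hn)

mutual

theorem Pos.valid_of_mem_canonical {R : LTerm → LTerm → Prop} (hR : HeadCompatible R)
    {Γ : ℕ → Option Ty} (hΓ : ∀ B N, ∃ x, N ≤ x ∧ Γ x = some B) {A : Ty} (hA : Pos A)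
    (ρ : ℕ → ℕ) {t : LTerm} (ht : t ∈ value A fun n => canonical hR Γ (ρ n)) :
    Valid R Γ t (rename ρ A) := by
  cases hA with
  | var n => exact ht
  | @arr B A hB hA =>
    intro t' htt I σ hσ v hv
    obtain ⟨N, hN⟩ := LTerm.exists_forall_freeIn_lt t'
    obtain ⟨x, hNx, hx⟩ := hΓ (rename ρ B) N
    have key := hA.valid_of_mem_canonical hR hΓ ρ
      (ht _ (hB.mem_canonical_of_valid hR hΓ ρ (Neutral.var x) (valid_var hR hx)))
      _ (hR.app_right _ htt) I _ (hσ.update hx hv)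
    have hσ' : subst (Function.update σ x v) t' = subst σ t' := subst_congr fun n hn =>
      Function.update_of_ne ((hN n hn).trans_le hNx).ne v σ
    simpa only [subst, hσ', Function.update_self] using key
  | @all A hA _ =>
    refine valid_all fun Y => hA.valid_of_mem_canonical hR hΓ (consRen Y ρ) ?_
    refine (value_congr fun n _ => ?_).subset (Set.mem_iInter.1 ht (canonical hR Γ Y))
    cases n <;> rfl

theorem Neg.mem_canonical_of_valid {R : LTerm → LTerm → Prop} (hR : HeadCompatible R)
    {Γ : ℕ → Option Ty} (hΓ : ∀ B N, ∃ x, N ≤ x ∧ Γ x = some B) {A : Ty} (hA : Neg A)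
    (ρ : ℕ → ℕ) {t : LTerm} (hn : Neutral t) (ht : Valid R Γ t (rename ρ A)) :
    t ∈ value A fun n => canonical hR Γ (ρ n) := by
  cases hA with
  | var n => exact ht
  | arr hB hA =>
    intro u hu
    refine hA.mem_canonical_of_valid hR hΓ ρ (hn.app u) fun w hw I σ hσ => ?_
    obtain ⟨t', u', hw', ht', hu'⟩ := hR.neutral hn hw
    have hσ' := hσ.of_weakHeadRed hw'
    exact saturated_value _ I _ _
      (ht t' ht' I σ (fun x hx => hσ' x (Or.inl hx)) _
        (hB.valid_of_mem_canonical hR hΓ ρ hu u' hu' I σ fun x hx => hσ' x (Or.inr hx)))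
      (hw'.subst σ)

end

theorem exists_context (N : ℕ) :
    ∃ Γ : ℕ → Option Ty, (∀ x < N, Γ x = none) ∧ ∀ B M, ∃ x, M ≤ x ∧ Γ x = some B := by
  have : Countable Ty := code_injective.countable
  obtain ⟨f, hf⟩ := @exists_surjective_nat Ty ⟨var 0⟩ this
  refine ⟨fun x => if x < N then none else some (f (Nat.unpair x).1), fun x hx => if_pos hx,
    fun B M => ?_⟩
  obtain ⟨k, rfl⟩ := hf B
  have h := Nat.right_le_pair k (max M N)
  refine ⟨Nat.pair k (max M N), (le_max_left M N).trans h, ?_⟩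
  simp only [if_neg ((le_max_right M N).trans h).not_gt, Nat.unpair_pair]

theorem rename_id (A : Ty) : rename id A = A := by
  induction A with
  | var n => rfl
  | arr A B ihA ihB => simp only [rename, ihA, ihB]
  | all A ih =>
    simp only [rename]
    rw [show upRen id = id from funext fun n => by cases n <;> rfl, ih]

theorem Pos.mem_sem_of_headCompatible {R : LTerm → LTerm → Prop} (hR : HeadCompatible R) {A : Ty}
    (hA : Pos A) {t t' : LTerm} (h : R t t') (ht : t ∈ A.sem) : t' ∈ A.sem := by
  obtain ⟨N, hN⟩ := LTerm.exists_forall_freeIn_lt t'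
  obtain ⟨Γ, hΓN, hΓ⟩ := exists_context N
  have key := hA.valid_of_mem_canonical hR hΓ id (Set.mem_iInter.1 ht _) t' h
  rw [rename_id] at key
  refine Set.mem_iInter.2 fun I => ?_
  have := key I LTerm.var fun x hx B hB => by
    rw [hΓN x (hN x hx)] at hB
    cases hB
  rwa [subst_var] at this

theorem Pos.mem_sem_iff_of_betaEquiv {A : Ty} (hA : Pos A) {t t' : LTerm} (h : BetaEquiv t t') :
    t ∈ A.sem ↔ t' ∈ A.sem := by
  induction h with
  | rel t t' h =>
    have h : BetaRed t t' := Relation.ReflTransGen.single h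
    exact ⟨hA.mem_sem_of_headCompatible headCompatible_betaRed h,
      hA.mem_sem_of_headCompatible headCompatible_flip_betaRed h⟩
  | refl t => exact Iff.rfl
  | symm t t' _ ih => exact ih.symm
  | trans t u v _ _ ih ih' => exact ih.trans ih'

end Ty

end SystemF

theorem mainTheorem2 (A : SystemF.Ty) (hA : SystemF.Ty.Pos A) (t : SystemF.LTerm) :
    (t ∈ A.sem →
      t.Normalizable ∧ ∃ s : SystemF.LTerm, s.Closed ∧ SystemF.LTerm.BetaEquiv t s) ∧
    (∀ t' : SystemF.LTerm, t ∈ A.sem → SystemF.LTerm.BetaEquiv t t' → t' ∈ A.sem) := by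
  refine ⟨fun ht => ?_, fun t' ht h => (hA.mem_sem_iff_of_betaEquiv h).1 ht⟩
  obtain ⟨n, hn, hn', hc⟩ := hA.exists_normal_closed ht
  exact ⟨⟨n, hn, hn'⟩, n, hc, hn.betaEquiv⟩
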